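/- A symmetric convex body is a compact convex subset, with nonempty interior, of a finite-dimensional real vector space, invariant under $x\mapsto -x$. A hyperplane is a linear subspace of codimension $1$; a hyperplane section of a set $B$ is the set $H\cap B$, where $H$ is a hyperplane, regarded as a subset of the vector space $H$. Two sets, each contained in a vector space, are linearly (affinely) equivalent if some linear (affine) isomorphism between their ambient vector spaces maps one onto the other. An ellipsoid is a set affinely equivalent to the closed unit ball of a Euclidean space. A symmetric convex body $K\subset\mathbb{R}^m$ is a symmetric body of revolution if there is a $1$-dimensional linear subspace $L\subset\mathbb{R}^m$ such that for every $p\in L$ the section $K\cap(p+L^\perp)$ is a closed Euclidean ball of $p+L^\perp$ centered at $p$ (possibly a single point or empty). An affine body of revolution is a set linearly equivalent to a symmetric body of revolution. **Theorem.** Let $n\ge 4$ and let $B\subset\mathbb{R}^{n+1}$ be a symmetric convex body. Suppose that any two hyperplane sections of $B$ are linearly equivalent and that every hyperplane section of $B$ is an affine body of revolution. Then $B$ is an ellipsoid. -/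

import Mathlib

/-- A symmetric convex body: a compact convex subset with nonempty interior, invariant under
`x ↦ -x`. -/
def IsSymmetricConvexBody {V : Type*} [AddCommGroup V] [Module ℝ V] [TopologicalSpace V]
    (K : Set V) : Prop :=
  IsCompact K ∧ Convex ℝ K ∧ (interior K).Nonempty ∧ ∀ x ∈ K, -x ∈ K

/-- A (linear) hyperplane: a linear subspace of codimension one. -/
def IsHyperplane {V : Type*} [AddCommGroup V] [Module ℝ V] (H : Submodule ℝ V) : Prop :=
  Module.finrank ℝ (V ⧸ H) = 1

/-- The section `H ∩ B`, viewed as a subset of the vector space `H`. -/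
def sectionBy {V : Type*} [AddCommGroup V] [Module ℝ V] (B : Set V) (H : Submodule ℝ V) : Set H :=
  {x : H | (x : V) ∈ B}

/-- Two sets, each in a vector space, are linearly equivalent if a linear isomorphism between
their ambient spaces maps one onto the other. -/
def LinearlyEquivalent {V W : Type*} [AddCommGroup V] [Module ℝ V] [AddCommGroup W] [Module ℝ W]
    (S : Set V) (T : Set W) : Prop :=
  ∃ e : V ≃ₗ[ℝ] W, e '' S = T

/-- Two sets, each in a vector space, are affinely equivalent if an affine isomorphism between
their ambient spaces maps one onto the other. -/
def AffinelyEquivalent {V W : Type*} [AddCommGroup V] [Module ℝ V] [AddCommGroup W] [Module ℝ W]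
    (S : Set V) (T : Set W) : Prop :=
  ∃ e : V ≃ᵃ[ℝ] W, e '' S = T

/-- An ellipsoid: a set affinely equivalent to the closed unit ball of a Euclidean space. -/
def IsEllipsoid {V : Type*} [AddCommGroup V] [Module ℝ V] (S : Set V) : Prop :=
  ∃ m : ℕ, AffinelyEquivalent S (Metric.closedBall (0 : EuclideanSpace ℝ (Fin m)) 1)

/-- `L` is an axis of revolution of `K`: it is a line through the origin, and each section of `K`
by an affine hyperplane `p + Lᗮ`, `p ∈ L`, orthogonal to `L` is a closed ball of that affine
hyperplane centered at `p` (empty if `r < 0`, a point if `r = 0`). -/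
def IsAxisOfRevolution {m : ℕ} (K : Set (EuclideanSpace ℝ (Fin m)))
    (L : Submodule ℝ (EuclideanSpace ℝ (Fin m))) : Prop :=
  Module.finrank ℝ L = 1 ∧
    ∀ p ∈ L, ∃ r : ℝ,
      K ∩ (AffineSubspace.mk' p Lᗮ : Set (EuclideanSpace ℝ (Fin m))) =
        Metric.closedBall p r ∩ (AffineSubspace.mk' p Lᗮ : Set (EuclideanSpace ℝ (Fin m)))

/-- A symmetric body of revolution in `ℝ^m`. -/
def IsSymmetricBodyOfRevolution {m : ℕ} (K : Set (EuclideanSpace ℝ (Fin m))) : Prop :=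
  IsSymmetricConvexBody K ∧ ∃ L, IsAxisOfRevolution K L

/-- An affine (symmetric) body of revolution: a set linearly equivalent to a symmetric body of
revolution in some `ℝ^m`. -/
def IsAffineBodyOfRevolution {V : Type*} [AddCommGroup V] [Module ℝ V] (K : Set V) : Prop :=
  ∃ (m : ℕ) (K' : Set (EuclideanSpace ℝ (Fin m))),
    IsSymmetricBodyOfRevolution K' ∧ LinearlyEquivalent K K'

/-!
Let `N` be the norm with unit ball `B`. Fix one hyperplane and identify its section with a body of
revolution about a unit vector `a` in a Euclidean space `E`; let `p` be the norm of that body. It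
depends only on `(⟪a, x⟫, ‖x‖)`. Since all sections are linearly equivalent, every hyperplane `H`
has a linear isomorphism `e_H : H ≃ E` with `p (e_H x) = N x`. It suffices to prove the
parallelogram law for `p`: any two vectors lie in a hyperplane, so `N` then satisfies it as well,
and `B` is an ellipsoid by the theorem of Jordan and von Neumann (`isEllipsoid_of_parallelogram`).

Suppose that `p ^ 2` is not a quadratic form. Three facts give a contradiction.

* In dimension at least three, a nonquadratic norm of revolution has only one axis and hyperplane of
  revolution (`quadratic_or_same_axis`). Both structures of revolution can be taken with respect
  to the same Euclidean form, one invariant under all isometries of the norm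
  (`exists_invariant_form`, `form_eq_of_invariant`). A function on the Euclidean sphere that is
  rotationally symmetric about two different axes is constant (`eq_of_two_axes`).
* Let `u` be the axis of a hyperplane `H₁`, and let `H₂` be another hyperplane through `u`. The
  section by `H₁ ⊓ H₂`, of dimension at least three, inherits a structure of revolution from both
  sides. By uniqueness they agree, and this expresses the profile
  `F t y = p (t • a + y • b)` as `F t y = F (c * t) √(y² + k t²)`. Iterating this identity shows
  that `c² = 1` and `k = 0` (`rigid_or_quadratic`). Hence `u` is also the axis of `H₂`, and the
  heights over the hyperplanes of revolution of `H₁` and `H₂` agree on `H₁ ⊓ H₂`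
  (`same_axis_of_mem_inf`).
* So the heights on all the hyperplanes through `u` glue to a linear functional on the whole space.
  Its kernel is a hyperplane, and any two of its vectors lie in the hyperplane of revolution of some
  `H` through `u`, where `N` is Euclidean. Thus the section by the kernel is Euclidean, and with it
  `p` (`parallelogram_of_hyperplanes`).
-/

/-! ### Invariant Euclidean forms -/

open Module MeasureTheory in
/-- A compact set with nonempty interior in a finite-dimensional space determines a positive
definite form that is preserved by every linear automorphism preserving the set: the form dual to
the second-moment form `(ξ, η) ↦ ∫_K ξ η` on the dual space (the Binet ellipsoid). -/
theorem exists_invariant_form {W : Type*} [NormedAddCommGroup W] [NormedSpace ℝ W]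
    [FiniteDimensional ℝ W] [MeasurableSpace W] [BorelSpace W] {K : Set W} (hK : IsCompact K)
    (hi : (interior K).Nonempty) :
    ∃ Q : W →ₗ[ℝ] W →ₗ[ℝ] ℝ, (∀ x y, Q x y = Q y x) ∧ (∀ x, x ≠ 0 → 0 < Q x x) ∧
      ∀ g : W ≃ₗ[ℝ] W, g '' K = K → ∀ x y, Q (g x) (g y) = Q x y := by
  set μ : Measure W := Measure.addHaar
  have hc : ∀ ξ : Dual ℝ W, Continuous ξ := fun ξ => LinearMap.continuous_of_finiteDimensional ξ
  have hint : ∀ ξ η : Dual ℝ W, IntegrableOn (fun x => ξ x * η x) K μ := fun ξ η =>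
    ((hc ξ).mul (hc η)).continuousOn.integrableOn_compact hK
  let D : Dual ℝ W →ₗ[ℝ] Dual ℝ W →ₗ[ℝ] ℝ := LinearMap.mk₂ ℝ
    (fun ξ η => ∫ x in K, ξ x * η x ∂μ)
    (fun ξ ξ' η => by
      simp only [LinearMap.add_apply, add_mul]
      exact integral_add (hint ξ η) (hint ξ' η))
    (fun c ξ η => by
      simp only [LinearMap.smul_apply, smul_eq_mul, mul_assoc]
      exact integral_const_mul c _)
    (fun ξ η η' => by
      simp only [LinearMap.add_apply, mul_add]
      exact integral_add (hint ξ η) (hint ξ η'))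
    (fun c ξ η => by
      simp only [LinearMap.smul_apply, smul_eq_mul, mul_left_comm _ c]
      exact integral_const_mul c _)
  have hD : ∀ ξ η, D ξ η = ∫ x in K, ξ x * η x ∂μ := fun ξ η => rfl
  have hDsymm : ∀ ξ η, D ξ η = D η ξ := fun ξ η => by simp only [hD, mul_comm]
  have hDpos : ∀ ξ, ξ ≠ 0 → 0 < D ξ ξ := by
    intro ξ hξ
    rw [hD, setIntegral_pos_iff_support_of_nonneg_ae
      (Filter.Eventually.of_forall fun x => mul_self_nonneg (ξ x)) (hint ξ ξ)]
    have hker : μ (LinearMap.ker ξ : Set W) = 0 :=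
      Measure.addHaar_submodule μ _ (by simpa [LinearMap.ker_eq_top] using hξ)
    have hKpos : 0 < μ K :=
      (isOpen_interior.measure_pos μ hi).trans_le (measure_mono interior_subset)
    have hsub : K \ (LinearMap.ker ξ : Set W) ⊆ (Function.support fun x => ξ x * ξ x) ∩ K := by
      rintro x ⟨hx, hx'⟩
      exact ⟨by simpa using hx', hx⟩
    refine lt_of_lt_of_le ?_ (measure_mono hsub)
    rwa [measure_sdiff_null hker]
  let T : Dual ℝ W →ₗ[ℝ] W := (evalEquiv ℝ W).symm.toLinearMap ∘ₗ D
  have hT : ∀ ξ η : Dual ℝ W, ξ (T η) = D η ξ := fun ξ η => by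
    simp [T, Module.apply_evalEquiv_symm_apply]
  have hTinj : Function.Injective T := by
    rw [← LinearMap.ker_eq_bot, LinearMap.ker_eq_bot']
    intro ξ h
    by_contra h0
    have := hDpos ξ h0
    rw [← hT, h, map_zero] at this
    exact this.false
  let e : Dual ℝ W ≃ₗ[ℝ] W := LinearEquiv.ofInjectiveOfFinrankEq T hTinj
    Subspace.dual_finrank_eq
  have he : ∀ ξ, e ξ = T ξ := fun ξ => rfl
  have hQ : ∀ ξ y, e.symm.toLinearMap (e ξ) y = ξ y := fun ξ y => by
    rw [LinearEquiv.coe_coe, e.symm_apply_apply]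
  refine ⟨e.symm.toLinearMap, ?_, ?_, ?_⟩
  · intro x y
    obtain ⟨ξ, rfl⟩ := e.surjective x
    obtain ⟨η, rfl⟩ := e.surjective y
    rw [hQ, hQ, he, he, hT, hT, hDsymm]
  · intro x hx
    obtain ⟨ξ, rfl⟩ := e.surjective x
    have : ξ ≠ 0 := by rintro rfl; simp at hx
    rw [hQ, he, hT]
    exact hDpos ξ this
  · intro g hg x y
    have hdet : |LinearMap.det (g : W →ₗ[ℝ] W)| = 1 := by
      have h := Measure.addHaar_image_linearMap μ (g : W →ₗ[ℝ] W) K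
      have hKpos : μ K ≠ 0 :=
        ((isOpen_interior.measure_pos μ hi).trans_le (measure_mono interior_subset)).ne'
      have hKfin : μ K ≠ ⊤ := hK.measure_lt_top.ne
      rw [LinearEquiv.coe_coe, hg] at h
      have h1 : 1 = ENNReal.ofReal |LinearMap.det (g : W →ₗ[ℝ] W)| :=
        (ENNReal.mul_left_inj hKpos hKfin).1 (by rw [one_mul]; exact h)
      have := congrArg ENNReal.toReal h1
      rw [ENNReal.toReal_ofReal (abs_nonneg _)] at this
      simpa using this.symm
    have hmp : MeasurePreserving g μ μ := by
      refine ⟨(LinearMap.continuous_of_finiteDimensional (g : W →ₗ[ℝ] W)).measurable, ?_⟩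
      have h := Measure.map_linearMap_addHaar_eq_smul_addHaar μ (f := (g : W →ₗ[ℝ] W))
        (by intro h; simp [h] at hdet)
      rw [abs_inv, hdet] at h
      simpa using h
    have hDg : ∀ ξ η : Dual ℝ W, D (ξ ∘ₗ (g : W →ₗ[ℝ] W)) (η ∘ₗ (g : W →ₗ[ℝ] W)) = D ξ η := by
      intro ξ η
      have := hmp.setIntegral_image_emb
        g.toContinuousLinearEquiv.toHomeomorph.measurableEmbedding
        (fun x => ξ x * η x) K
      rw [hg] at this
      exact this.symm
    obtain ⟨ζ, rfl⟩ := e.surjective x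
    obtain ⟨ξ, rfl⟩ : ∃ ξ : Dual ℝ W, ζ = ξ ∘ₗ (g : W →ₗ[ℝ] W) :=
      ⟨ζ ∘ₗ (g.symm : W →ₗ[ℝ] W), by ext; simp⟩
    have hgT : g (e (ξ ∘ₗ (g : W →ₗ[ℝ] W))) = e ξ := by
      rw [← sub_eq_zero, ← forall_dual_apply_eq_zero_iff ℝ]
      intro η
      rw [map_sub, sub_eq_zero]
      have := hT (η ∘ₗ (g : W →ₗ[ℝ] W)) (ξ ∘ₗ (g : W →ₗ[ℝ] W))
      rw [hDg] at this
      rw [he, he, hT, ← this]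
      rfl
    rw [hgT, hQ, hQ]
    rfl

/-- A symmetric form that is invariant under all linear isometries of a positive definite form `β`
fixing a functional `α` is a combination of `β` and `α²`. -/
theorem form_eq_of_invariant {W : Type*} [AddCommGroup W] [Module ℝ W]
    {Q β : W →ₗ[ℝ] W →ₗ[ℝ] ℝ} {α : W →ₗ[ℝ] ℝ} (hQs : ∀ x y, Q x y = Q y x)
    (hβs : ∀ x y, β x y = β y x) (hQp : ∀ x, x ≠ 0 → 0 < Q x x) (hβp : ∀ x, x ≠ 0 → 0 < β x x)
    (hα : LinearMap.ker α ≠ ⊥)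
    (hinv : ∀ g : W ≃ₗ[ℝ] W, (∀ x y, β (g x) (g y) = β x y) → (∀ x, α (g x) = α x) →
      ∀ x y, Q (g x) (g y) = Q x y)
    {a : W} (ha : ∀ x, β a x = α x) :
    ∃ l m : ℝ, 0 < l ∧ ∀ x y, Q x y = l * β x y + m * (α x * α y) := by
  -- Invariance under the `β`-reflection in `w ∈ ker α` makes `Q w` proportional to `β w`.
  have key : ∀ w, w ≠ 0 → α w = 0 → ∀ x, Q w x = Q w w / β w w * β w x := by
    intro w hw hαw x
    have hb := (hβp w hw).ne'
    let R : W →ₗ[ℝ] W := LinearMap.id - (2 / β w w) • (β w).smulRight w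
    have hR : ∀ x, R x = x - (2 / β w w * β w x) • w := fun x => by
      simp [R, smul_smul]
    have hRR : ∀ x, R (R x) = x := by
      intro x
      rw [hR (R x), hR x]
      simp only [map_sub, map_smul, smul_eq_mul]
      have : 2 / β w w * (β w x - 2 / β w w * β w x * β w w) = - (2 / β w w * β w x) := by
        field_simp; ring
      rw [this]; simp
    let g : W ≃ₗ[ℝ] W := LinearEquiv.ofInvolutive R hRR
    have hg : ∀ x, g x = x - (2 / β w w * β w x) • w := hR
    have h := hinv g
      (by
        intro x y
        rw [hg, hg]
        simp only [map_sub, map_smul, smul_eq_mul, LinearMap.sub_apply, LinearMap.smul_apply,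
          hβs x w]
        field_simp; ring)
      (by intro x; rw [hg]; simp [hαw]) x w
    rw [hg, hg] at h
    simp only [map_sub, map_smul, smul_eq_mul, LinearMap.sub_apply, LinearMap.smul_apply,
      hQs x w] at h
    field_simp at h ⊢
    linarith
  obtain ⟨w₀, hw₀, hne⟩ := Submodule.exists_mem_ne_zero_of_ne_bot hα
  rw [LinearMap.mem_ker] at hw₀
  set l := Q w₀ w₀ / β w₀ w₀
  have hlpos : 0 < l := div_pos (hQp _ hne) (hβp _ hne)
  have key1 : ∀ w, α w = 0 → β w w₀ ≠ 0 → ∀ x, Q w x = l * β w x := by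
    intro w hw hb x
    have hw0 : w ≠ 0 := by rintro rfl; simp at hb
    have h1 := key w hw0 hw w₀
    have h2 := key w₀ hne hw₀ w
    rw [hQs w₀ w, hβs w₀ w, h1] at h2
    rw [key w hw0 hw, mul_right_cancel₀ hb h2]
  have key2 : ∀ w, α w = 0 → ∀ x, Q w x = l * β w x := by
    intro w hw x
    by_cases hb : β w w₀ = 0
    · have h1 := key1 (w + w₀) (by simp [hw, hw₀])
        (by simpa [hb] using (hβp _ hne).ne') x
      have h2 := key1 w₀ hw₀ (hβp _ hne).ne' x
      simp only [map_add, LinearMap.add_apply] at h1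
      linarith
    · exact key1 w hw hb x
  by_cases ha0 : α a = 0
  · have h0 : a = 0 := by
      by_contra h
      have := hβp a h
      rw [ha, ha0] at this
      exact this.false
    have hα0 : ∀ x, α x = 0 := fun x => by rw [← ha, h0]; simp
    exact ⟨l, 0, hlpos, fun x y => by rw [key2 x (hα0 x) y]; ring⟩
  · refine ⟨l, (Q a a - l * β a a) / α a ^ 2, hlpos, fun x y => ?_⟩
    have hx := key2 (x - (α x / α a) • a) (by simp [ha0])
    have hy := key2 (y - (α y / α a) • a) (by simp [ha0]) a
    have hxy := hx y
    simp only [map_sub, map_smul, smul_eq_mul, LinearMap.sub_apply, LinearMap.smul_apply]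
      at hxy hy
    rw [hQs y a, hβs y a] at hy
    have e1 : Q x y = l * β x y + α x / α a * (Q a y - l * β a y) := by linarith
    have e2 : Q a y = l * β a y + α y / α a * (Q a a - l * β a a) := by linarith
    rw [e1, e2]
    field_simp
    ring

/-! ### Uniqueness of the axis of revolution -/

open Filter Topology in
/-- A function on the unit sphere of the form `Q` that depends only on the `Q`-angle to `a₁`, and
also only on the `Q`-angle to another axis `a₂`, is constant, provided that some direction `z` is
orthogonal to both axes. The unit vectors at height `t` over `a₁` and at height `t * c` over `a₂`,
where `c = Q a₁ a₂`, have a common member, so the value at height `t` is the value at height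
`t * c ^ 2`, and hence at height `0`. -/
theorem eq_of_two_axes {W : Type*} [NormedAddCommGroup W] [NormedSpace ℝ W]
    {Q : W →ₗ[ℝ] W →ₗ[ℝ] ℝ} (hQs : ∀ x y, Q x y = Q y x) {N : W → ℝ} (hN : Continuous N)
    {a₁ a₂ z : W} (h11 : Q a₁ a₁ = 1) (h22 : Q a₂ a₂ = 1) (hzz : Q z z = 1)
    (h1z : Q a₁ z = 0) (h2z : Q a₂ z = 0) (hc : |Q a₁ a₂| < 1)
    (hN1 : ∀ x y, Q a₁ x = Q a₁ y → Q x x = Q y y → N x = N y)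
    (hN2 : ∀ x y, Q a₂ x = Q a₂ y → Q x x = Q y y → N x = N y)
    {x : W} (hx : Q x x = 1) (hx1 : Q a₁ x ^ 2 ≤ 1) : N x = N z := by
  set c := Q a₁ a₂ with hcdef
  have hz1 : Q z a₁ = 0 := by rw [hQs, h1z]
  have hz2 : Q z a₂ = 0 := by rw [hQs, h2z]
  have h21 : Q a₂ a₁ = c := by rw [hQs]
  let X (a : W) (t : ℝ) : W := t • a + √(1 - t ^ 2) • z
  have hXu : ∀ a, Q a a = 1 → Q a z = 0 → Q z a = 0 → ∀ t, t ^ 2 ≤ 1 → Q (X a t) (X a t) = 1 := by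
    intro a haa haz hza t ht
    have := Real.mul_self_sqrt (sub_nonneg.2 ht)
    simp only [X, map_add, map_smul, LinearMap.add_apply, LinearMap.smul_apply, smul_eq_mul,
      haa, haz, hza, hzz]
    linear_combination this
  have hc2 : c ^ 2 ≤ 1 := by rw [← sq_abs]; nlinarith [abs_nonneg c]
  have hstep : ∀ t, t ^ 2 ≤ 1 → N (X a₁ t) = N (X a₁ (t * c ^ 2)) := by
    intro t ht
    have ht1 : (t * c) ^ 2 ≤ 1 := by
      rw [mul_pow]; exact mul_le_one₀ ht (sq_nonneg c) hc2
    have ht2 : (t * c ^ 2) ^ 2 ≤ 1 := by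
      have : (t * c ^ 2) ^ 2 = (t * c) ^ 2 * c ^ 2 := by ring
      rw [this]; exact mul_le_one₀ ht1 (sq_nonneg c) hc2
    have e1 : N (X a₁ t) = N (X a₂ (t * c)) := hN2 _ _
      (by simp [X, h21, h22, h2z]) (by rw [hXu a₁ h11 h1z hz1 t ht, hXu a₂ h22 h2z hz2 _ ht1])
    have e2 : N (X a₁ (t * c ^ 2)) = N (X a₂ (t * c)) := hN1 _ _
      (by simp [X, h11, h1z, ← hcdef]; ring)
      (by rw [hXu a₁ h11 h1z hz1 _ ht2, hXu a₂ h22 h2z hz2 _ ht1])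
    rw [e1, e2]
  set t := Q a₁ x
  have hle : ∀ j : ℕ, (t * (c ^ 2) ^ j) ^ 2 ≤ 1 := fun j => by
    rw [mul_pow]
    exact mul_le_one₀ hx1 (sq_nonneg _)
      (pow_le_one₀ (pow_nonneg (sq_nonneg c) j) (pow_le_one₀ (sq_nonneg c) hc2))
  have hiter : ∀ j : ℕ, N (X a₁ (t * (c ^ 2) ^ j)) = N (X a₁ t) := by
    intro j
    induction j with
    | zero => simp
    | succ j ih => rw [← ih, hstep _ (hle j), pow_succ, mul_assoc]
  have hlim : Tendsto (fun j : ℕ => t * (c ^ 2) ^ j) atTop (𝓝 0) := by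
    have := (tendsto_pow_atTop_nhds_zero_of_lt_one (sq_nonneg c)
      ((sq_lt_one_iff_abs_lt_one c).2 hc)).const_mul t
    simpa using this
  have hcont : Continuous fun s => N (X a₁ s) := by
    refine hN.comp ?_
    fun_prop
  have h0 := (hcont.tendsto 0).comp hlim
  have hconst : N (X a₁ t) = N (X a₁ 0) := by
    refine tendsto_nhds_unique ?_ h0
    simp only [Function.comp_def, hiter]
    exact tendsto_const_nhds
  have hX0 : X a₁ 0 = z := by simp [X]
  rw [← hX0, ← hconst]
  exact hN1 _ _ (by simp [X, h11, h1z, t]) (by rw [hx, hXu a₁ h11 h1z hz1 t hx1])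

theorem exists_eq_form_apply {W : Type*} [AddCommGroup W] [Module ℝ W] [FiniteDimensional ℝ W]
    {β : W →ₗ[ℝ] W →ₗ[ℝ] ℝ} (hβp : ∀ x, x ≠ 0 → 0 < β x x) (α : W →ₗ[ℝ] ℝ) :
    ∃ a, ∀ x, β a x = α x := by
  have hinj : Function.Injective β := by
    rw [← LinearMap.ker_eq_bot, LinearMap.ker_eq_bot']
    intro x hx
    by_contra h
    have := hβp x h
    rw [hx] at this
    exact this.false
  have hsurj := (LinearMap.injective_iff_surjective_of_finrank_eq_finrank
    (Subspace.dual_finrank_eq (K := ℝ) (V := W)).symm).1 hinj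
  obtain ⟨a, ha⟩ := hsurj α
  exact ⟨a, fun x => by rw [ha]⟩

/-- The kernels of two functionals on a space of dimension at least three meet nontrivially. -/
theorem exists_ne_zero_of_two_functionals {W : Type*} [AddCommGroup W] [Module ℝ W]
    [FiniteDimensional ℝ W] (hdim : 3 ≤ Module.finrank ℝ W) (f g : W →ₗ[ℝ] ℝ) :
    ∃ z, z ≠ 0 ∧ f z = 0 ∧ g z = 0 := by
  have hk : LinearMap.ker (f.prod g) ≠ ⊥ := by
    intro h
    have h1 := LinearMap.finrank_range_add_finrank_ker (f.prod g)
    have h2 := Submodule.finrank_le (LinearMap.range (f.prod g))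
    rw [h, finrank_bot] at h1
    simp at h2
    omega
  obtain ⟨z, hz, hne⟩ := Submodule.exists_mem_ne_zero_of_ne_bot hk
  rw [LinearMap.mem_ker, LinearMap.prod_apply] at hz
  exact ⟨z, hne, congrArg Prod.fst hz, congrArg Prod.snd hz⟩

/-- Uniqueness of the structure of revolution in dimension at least three: if a norm depends only
on `(α₁ x, β₁ x x)`, and also only on `(α₂ x, β₂ x x)`, then either its square is a quadratic form
or the two pairs have the same axis and hyperplane of revolution. -/
theorem quadratic_or_same_axis {W : Type*} [NormedAddCommGroup W] [NormedSpace ℝ W]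
    [FiniteDimensional ℝ W] (hdim : 3 ≤ Module.finrank ℝ W)
    (N : Seminorm ℝ W) (hNc : Continuous N) (hK : IsCompact {x | N x ≤ 1})
    {α₁ α₂ : W →ₗ[ℝ] ℝ} {β₁ β₂ : W →ₗ[ℝ] W →ₗ[ℝ] ℝ}
    (hs₁ : ∀ x y, β₁ x y = β₁ y x) (hs₂ : ∀ x y, β₂ x y = β₂ y x)
    (hp₁ : ∀ x, x ≠ 0 → 0 < β₁ x x) (hp₂ : ∀ x, x ≠ 0 → 0 < β₂ x x)
    (hN₁ : ∀ x y, α₁ x = α₁ y → β₁ x x = β₁ y y → N x = N y)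
    (hN₂ : ∀ x y, α₂ x = α₂ y → β₂ x x = β₂ y y → N x = N y) :
    (∃ l m : ℝ, ∀ x, N x ^ 2 = l * β₁ x x + m * α₁ x ^ 2) ∨
      ∃ c l m : ℝ, ∀ x y, α₂ x = c * α₁ x ∧ β₂ x y = l * β₁ x y + m * (α₁ x * α₁ y) := by
  borelize W
  have hi : (interior {x | N x ≤ 1}).Nonempty := by
    refine ⟨0, mem_interior.2 ⟨{x | N x < 1}, fun x (hx : N x < 1) => show N x ≤ 1 from hx.le,
      isOpen_lt hNc continuous_const, by simp⟩⟩
  obtain ⟨Q, hQs, hQp, hQinv⟩ := exists_invariant_form hK hi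
  have hQinv' : ∀ g : W ≃ₗ[ℝ] W, (∀ x, N (g x) = N x) → ∀ x y, Q (g x) (g y) = Q x y := by
    intro g hg
    refine hQinv g (Set.Subset.antisymm ?_ ?_)
    · rintro _ ⟨x, hx, rfl⟩
      simpa [hg] using hx
    · intro x hx
      refine ⟨g.symm x, ?_, by simp⟩
      have := hg (g.symm x)
      rw [g.apply_symm_apply] at this
      simpa [← this] using hx
  have decomp : ∀ (α : W →ₗ[ℝ] ℝ) (β : W →ₗ[ℝ] W →ₗ[ℝ] ℝ), (∀ x y, β x y = β y x) →
      (∀ x, x ≠ 0 → 0 < β x x) → (∀ x y, α x = α y → β x x = β y y → N x = N y) →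
      ∃ l m : ℝ, 0 < l ∧ ∀ x y, Q x y = l * β x y + m * (α x * α y) := by
    intro α β hβs hβp hN
    obtain ⟨a, ha⟩ := exists_eq_form_apply hβp α
    obtain ⟨z, hz, hz1, -⟩ := exists_ne_zero_of_two_functionals hdim α α
    refine form_eq_of_invariant hQs hβs hQp hβp ?_ ?_ ha
    · intro h
      have : z ∈ LinearMap.ker α := hz1
      rw [h] at this
      exact hz this
    · exact fun g h1 h2 => hQinv' g fun x => hN _ _ (h2 x) (h1 x x)
  obtain ⟨l₁, m₁, hl₁, hQ₁⟩ := decomp α₁ β₁ hs₁ hp₁ hN₁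
  obtain ⟨l₂, m₂, hl₂, hQ₂⟩ := decomp α₂ β₂ hs₂ hp₂ hN₂
  have hNQ₁ : ∀ x y, α₁ x = α₁ y → Q x x = Q y y → N x = N y := by
    intro x y h1 h2
    refine hN₁ x y h1 ?_
    rw [hQ₁, hQ₁, h1] at h2
    exact mul_left_cancel₀ hl₁.ne' (add_right_cancel h2)
  have hNQ₂ : ∀ x y, α₂ x = α₂ y → Q x x = Q y y → N x = N y := by
    intro x y h1 h2
    refine hN₂ x y h1 ?_
    rw [hQ₂, hQ₂, h1] at h2
    exact mul_left_cancel₀ hl₂.ne' (add_right_cancel h2)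
  have normalize : ∀ x, x ≠ 0 → ∃ s : ℝ, 0 < s ∧ Q (s • x) (s • x) = 1 := by
    intro x hx
    have h := hQp x hx
    refine ⟨(√(Q x x))⁻¹, by positivity, ?_⟩
    simp only [map_smul, LinearMap.smul_apply, smul_eq_mul]
    rw [← mul_assoc, ← mul_inv, Real.mul_self_sqrt h.le, inv_mul_cancel₀ h.ne']
  -- If the norm is constant on the unit sphere of `Q`, its square is a multiple of `Q`.
  have quad : ∀ D : ℝ, (∀ x, Q x x = 1 → N x = D) →
      ∃ l m : ℝ, ∀ x, N x ^ 2 = l * β₁ x x + m * α₁ x ^ 2 := by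
    intro D hD
    refine ⟨D ^ 2 * l₁, D ^ 2 * m₁, fun x => ?_⟩
    have : N x ^ 2 = D ^ 2 * Q x x := by
      by_cases hx : x = 0
      · simp [hx]
      · obtain ⟨s, hs, h1⟩ := normalize x hx
        have h2 := hD _ h1
        rw [map_smul_eq_mul, Real.norm_of_nonneg hs.le] at h2
        simp only [map_smul, LinearMap.smul_apply, smul_eq_mul] at h1
        rw [← h2]
        linear_combination (-N x ^ 2) * h1
    rw [this, hQ₁]
    ring
  obtain ⟨b₁, hb₁⟩ := exists_eq_form_apply hQp α₁
  obtain ⟨b₂, hb₂⟩ := exists_eq_form_apply hQp α₂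
  by_cases h0 : b₁ = 0
  · left
    obtain ⟨z, hz, -, -⟩ := exists_ne_zero_of_two_functionals hdim α₁ α₁
    obtain ⟨s, hs, hz1⟩ := normalize z hz
    refine quad (N (s • z)) fun x hx => hNQ₁ _ _ ?_ (by rw [hx, hz1])
    rw [← hb₁, ← hb₁, h0]; simp
  by_cases hpar : ∃ c : ℝ, b₂ = c • b₁
  · right
    obtain ⟨c, hc⟩ := hpar
    have hα : ∀ x, α₂ x = c * α₁ x := fun x => by rw [← hb₂, ← hb₁, hc]; simp
    refine ⟨c, l₁ / l₂, (m₁ - m₂ * c ^ 2) / l₂, fun x y => ⟨hα x, ?_⟩⟩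
    have h := hQ₂ x y
    rw [hQ₁ x y, hα, hα] at h
    field_simp
    linarith
  · left
    have h02 : b₂ ≠ 0 := fun h => hpar ⟨0, by simp [h]⟩
    obtain ⟨s₁, hs₁, h11⟩ := normalize b₁ h0
    obtain ⟨s₂, hs₂, h22⟩ := normalize b₂ h02
    obtain ⟨z, hz, hz1, hz2⟩ := exists_ne_zero_of_two_functionals hdim α₁ α₂
    obtain ⟨s, hs, hzz⟩ := normalize z hz
    have cs : ∀ x y, Q x x = 1 → Q y y = 1 → Q (y - Q x y • x) (y - Q x y • x) = 1 - Q x y ^ 2 := by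
      intro x y hx hy
      simp only [map_sub, map_smul, LinearMap.sub_apply, LinearMap.smul_apply, smul_eq_mul, hx, hy,
        hQs y x]
      ring
    have hQnn : ∀ x, 0 ≤ Q x x := fun x => by
      by_cases hx : x = 0
      · simp [hx]
      · exact (hQp x hx).le
    refine quad (N (s • z)) fun x hx => eq_of_two_axes hQs hNc h11 h22 hzz ?_ ?_ ?_ ?_ ?_ hx ?_
    · simp [hb₁, hz1]
    · simp [hb₂, hz2]
    · rw [← sq_lt_one_iff_abs_lt_one, ← sub_pos, ← cs _ _ h11 h22]
      refine hQp _ fun h => hpar ?_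
      rw [sub_eq_zero] at h
      generalize Q (s₁ • b₁) (s₂ • b₂) = c at h
      refine ⟨s₂⁻¹ * (c * s₁), ?_⟩
      rw [mul_smul, mul_smul, ← h, smul_smul, inv_mul_cancel₀ hs₂.ne', one_smul]
    · intro x y h1 h2
      refine hNQ₁ x y ?_ h2
      simp only [map_smul, LinearMap.smul_apply, smul_eq_mul, hb₁] at h1
      exact mul_left_cancel₀ hs₁.ne' h1
    · intro x y h1 h2
      refine hNQ₂ x y ?_ h2
      simp only [map_smul, LinearMap.smul_apply, smul_eq_mul, hb₂] at h1
      exact mul_left_cancel₀ hs₂.ne' h1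
    · rw [← sub_nonneg, ← cs _ _ h11 hx]
      exact hQnn _

/-! ### Hyperplanes sharing an axis -/

open Filter Topology in
/-- Rigidity of the profile of a norm of revolution about `a`: if the profile
`F t y = p (t • a + y • b)` satisfies `F t y = F (c * t) √(y² + k t²)`, then either this
substitution is trivial or the norm is quadratic. For `|c| < 1` the iterates of the substitution converge to the
hyperplane of revolution, where `p` is Euclidean; `|c| > 1` is excluded by monotonicity of `F`, and
for `|c| = 1` the iterates are unbounded unless `k = 0`. -/
theorem rigid_or_quadratic {E : Type*} [NormedAddCommGroup E] [InnerProductSpace ℝ E]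
    (p : Seminorm ℝ E) (hpc : Continuous p) (hpos : ∀ x, x ≠ 0 → 0 < p x) {a b : E}
    (ha : ‖a‖ = 1) (hb : ‖b‖ = 1) (hab : inner ℝ a b = 0)
    (hinv : ∀ x y, inner ℝ a x = inner ℝ a y → ‖x‖ ^ 2 = ‖y‖ ^ 2 → p x = p y)
    {c k : ℝ} (hk : 0 ≤ k)
    (h : ∀ t y : ℝ, p (t • a + y • b) = p ((c * t) • a + √(y ^ 2 + k * t ^ 2) • b)) :
    (c ^ 2 = 1 ∧ k = 0) ∨ ∃ l m : ℝ, ∀ x, p x ^ 2 = l * ‖x‖ ^ 2 + m * inner ℝ a x ^ 2 := by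
  have hba : inner ℝ b a = 0 := by rw [real_inner_comm, hab]
  have haa : inner ℝ a a = 1 := by rw [real_inner_self_eq_norm_sq, ha, one_pow]
  have hbb : inner ℝ b b = 1 := by rw [real_inner_self_eq_norm_sq, hb, one_pow]
  have hin : ∀ t y : ℝ, inner ℝ a (t • a + y • b) = t := fun t y => by
    simp only [inner_add_right, inner_smul_right, haa, hab]
    ring
  have hnorm : ∀ t y : ℝ, ‖t • a + y • b‖ ^ 2 = t ^ 2 + y ^ 2 := fun t y => by
    rw [← real_inner_self_eq_norm_sq]
    simp only [inner_add_right, inner_smul_right, inner_add_left, real_inner_smul_left, haa, hab,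
      hba, hbb]
    ring
  have hpa : 0 < p a := hpos a (by rintro rfl; simp at ha)
  have hpb : 0 < p b := hpos b (by rintro rfl; simp at hb)
  have hflip : ∀ t y : ℝ, p (t • a - y • b) = p (t • a + y • b) := fun t y => by
    rw [sub_eq_add_neg, ← neg_smul]
    exact hinv _ _ (by rw [hin, hin]) (by rw [hnorm, hnorm, neg_sq])
  have hge_a : ∀ t y : ℝ, |t| * p a ≤ p (t • a + y • b) := fun t y => by
    have h1 := map_add_le_add p (t • a + y • b) (t • a - y • b)
    have h2 : t • a + y • b + (t • a - y • b) = (2 * t) • a := by module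
    rw [h2, hflip, map_smul_eq_mul, Real.norm_eq_abs, abs_mul, abs_two] at h1
    linarith
  have hge_b : ∀ t y : ℝ, |y| * p b ≤ p (t • a + y • b) := fun t y => by
    have h1 := map_sub_le_add p (t • a + y • b) (t • a - y • b)
    have h2 : t • a + y • b - (t • a - y • b) = (2 * y) • b := by module
    rw [h2, hflip, map_smul_eq_mul, Real.norm_eq_abs, abs_mul, abs_two] at h1
    linarith
  rcases lt_or_ge (c ^ 2) 1 with hc | hc
  · right
    -- `y² + κ t²` is preserved by the substitution.
    set κ := k / (1 - c ^ 2)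
    have hκ0 : 0 ≤ κ := div_nonneg hk (by linarith)
    have hκk : κ * (1 - c ^ 2) = k := div_mul_cancel₀ _ (by linarith)
    have hpow : ∀ j : ℕ, 0 ≤ 1 - (c ^ 2) ^ j := fun j =>
      sub_nonneg.2 (pow_le_one₀ (sq_nonneg c) hc.le)
    have hiter : ∀ (t y : ℝ) (j : ℕ), p (t • a + y • b) =
        p ((c ^ j * t) • a + √(y ^ 2 + κ * t ^ 2 * (1 - (c ^ 2) ^ j)) • b) := by
      intro t y j
      induction j with
      | zero =>
        refine hinv _ _ (by rw [hin, hin]; simp) ?_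
        rw [hnorm, hnorm, Real.sq_sqrt (by simpa using sq_nonneg y)]
        simp
      | succ j ih =>
        rw [ih, h, Real.sq_sqrt (by have := hpow j; positivity)]
        have e1 : c * (c ^ j * t) = c ^ (j + 1) * t := by ring
        have e2 : y ^ 2 + κ * t ^ 2 * (1 - (c ^ 2) ^ j) + k * (c ^ j * t) ^ 2 =
            y ^ 2 + κ * t ^ 2 * (1 - (c ^ 2) ^ (j + 1)) := by
          rw [← hκk]; ring
        rw [e1, e2]
    have habs : |c| < 1 := (sq_lt_one_iff_abs_lt_one c).1 hc
    have hlim : ∀ t y : ℝ, p (t • a + y • b) = √(y ^ 2 + κ * t ^ 2) * p b := by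
      intro t y
      have l1 : Tendsto (fun j : ℕ => c ^ j * t) atTop (𝓝 0) := by
        simpa using (tendsto_pow_atTop_nhds_zero_of_abs_lt_one habs).mul_const t
      have l2 : Tendsto (fun j : ℕ => √(y ^ 2 + κ * t ^ 2 * (1 - (c ^ 2) ^ j))) atTop
          (𝓝 √(y ^ 2 + κ * t ^ 2)) := by
        have := ((((tendsto_pow_atTop_nhds_zero_of_lt_one (sq_nonneg c) hc).const_sub 1).const_mul
          (κ * t ^ 2)).const_add (y ^ 2)).sqrt
        simpa using this
      have l3 := (hpc.tendsto _).comp ((l1.smul_const a).add (l2.smul_const b))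
      have := tendsto_nhds_unique (tendsto_const_nhds.congr fun j => hiter t y j) l3
      rw [this, zero_smul, zero_add, map_smul_eq_mul, Real.norm_of_nonneg (Real.sqrt_nonneg _)]
    refine ⟨p b ^ 2, (κ - 1) * p b ^ 2, fun x => ?_⟩
    have hcs : inner ℝ a x ^ 2 ≤ ‖x‖ ^ 2 := by
      have := abs_real_inner_le_norm a x
      rw [ha, one_mul] at this
      rw [← sq_abs]
      gcongr
    have hx : p x = p (inner ℝ a x • a + √(‖x‖ ^ 2 - inner ℝ a x ^ 2) • b) := by
      refine hinv _ _ (by rw [hin]) ?_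
      rw [hnorm, Real.sq_sqrt (by linarith)]
      ring
    rw [hx, hlim, mul_pow, Real.sq_sqrt (by positivity), Real.sq_sqrt (by linarith)]
    ring
  · left
    have hc1 : c ^ 2 = 1 := by
      have h1 := h 1 0
      have h2 := hge_a (c * 1) √(0 ^ 2 + k * 1 ^ 2)
      rw [← h1] at h2
      simp only [one_smul, zero_smul, add_zero, mul_one] at h2
      have h3 : |c| ≤ 1 := by
        by_contra hlt
        push Not at hlt
        nlinarith
      exact le_antisymm ((sq_le_one_iff_abs_le_one c).2 h3) hc
    refine ⟨hc1, ?_⟩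
    have hiter : ∀ j : ℕ, p a = p (c ^ j • a + √(j * k) • b) := by
      intro j
      induction j with
      | zero => simp
      | succ j ih =>
        rw [ih, h, Real.sq_sqrt (by positivity)]
        have e1 : c * c ^ j = c ^ (j + 1) := by ring
        have e2 : j * k + k * (c ^ j) ^ 2 = ((j + 1 : ℕ) : ℝ) * k := by
          rw [← pow_mul, mul_comm j 2, pow_mul, hc1, one_pow]
          push_cast
          ring
        rw [e1, e2]
    by_contra hk0
    have hkpos : 0 < k := lt_of_le_of_ne hk (Ne.symm hk0)
    obtain ⟨j, hj⟩ := exists_nat_gt (p a ^ 2 / (k * p b ^ 2))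
    rw [div_lt_iff₀ (by positivity)] at hj
    have h1 := hge_b (c ^ j) √(j * k)
    rw [← hiter, abs_of_nonneg (Real.sqrt_nonneg _)] at h1
    have h2 : (√(j * k) * p b) ^ 2 ≤ p a ^ 2 := by gcongr
    rw [mul_pow, Real.sq_sqrt (by positivity)] at h2
    linarith

/-- Two hyperplanes (or just subspaces with an intersection of dimension at least three) are
identified with the same nonquadratic norm of revolution `p`. If their intersection contains the
axis `u` of the first one, then `u` is also an axis of the second one, and the two heights over the
hyperplanes of revolution agree on the intersection. -/
theorem same_axis_of_mem_inf {V E : Type*} [NormedAddCommGroup V] [NormedSpace ℝ V]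
    [FiniteDimensional ℝ V] [NormedAddCommGroup E] [InnerProductSpace ℝ E]
    (N : Seminorm ℝ V) (hNc : Continuous N) (hK : IsCompact {x | N x ≤ 1})
    (p : Seminorm ℝ E) (hpc : Continuous p) (hpos : ∀ x, x ≠ 0 → 0 < p x) {a : E}
    (ha : ‖a‖ = 1)
    (hinv : ∀ x y, inner ℝ a x = inner ℝ a y → ‖x‖ ^ 2 = ‖y‖ ^ 2 → p x = p y)
    (hnq : ¬∃ l m : ℝ, ∀ x, p x ^ 2 = l * ‖x‖ ^ 2 + m * inner ℝ a x ^ 2)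
    {H₁ H₂ : Submodule ℝ V} (hdim : 3 ≤ Module.finrank ℝ ↥(H₁ ⊓ H₂))
    (e₁ : H₁ ≃ₗ[ℝ] E) (e₂ : H₂ ≃ₗ[ℝ] E) (he₁ : ∀ x, p (e₁ x) = N x) (he₂ : ∀ x, p (e₂ x) = N x)
    {u : V} (hu₁ : u ∈ H₁) (hu₂ : u ∈ H₂) (hua : e₁ ⟨u, hu₁⟩ = a) :
    (e₂ ⟨u, hu₂⟩ = a ∨ e₂ ⟨u, hu₂⟩ = -a) ∧
      ∀ x (h₁ : x ∈ H₁) (h₂ : x ∈ H₂),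
        inner ℝ (e₂ ⟨x, h₂⟩) (e₂ ⟨u, hu₂⟩) = inner ℝ (e₁ ⟨x, h₁⟩) (e₁ ⟨u, hu₁⟩) := by
  let f₁ : ↥(H₁ ⊓ H₂) →ₗ[ℝ] E := e₁.toLinearMap ∘ₗ Submodule.inclusion inf_le_left
  let f₂ : ↥(H₁ ⊓ H₂) →ₗ[ℝ] E := e₂.toLinearMap ∘ₗ Submodule.inclusion inf_le_right
  have hf₁ : Function.Injective f₁ := e₁.injective.comp (Submodule.inclusion_injective _)
  have hf₂ : Function.Injective f₂ := e₂.injective.comp (Submodule.inclusion_injective _)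
  have hpf₁ : ∀ x, p (f₁ x) = N x := fun x => he₁ _
  have hpf₂ : ∀ x, p (f₂ x) = N x := fun x => he₂ _
  let α₁ : ↥(H₁ ⊓ H₂) →ₗ[ℝ] ℝ := innerₗ E a ∘ₗ f₁
  let α₂ : ↥(H₁ ⊓ H₂) →ₗ[ℝ] ℝ := innerₗ E a ∘ₗ f₂
  let β₁ : ↥(H₁ ⊓ H₂) →ₗ[ℝ] ↥(H₁ ⊓ H₂) →ₗ[ℝ] ℝ := (innerₗ E).compl₁₂ f₁ f₁
  let β₂ : ↥(H₁ ⊓ H₂) →ₗ[ℝ] ↥(H₁ ⊓ H₂) →ₗ[ℝ] ℝ := (innerₗ E).compl₁₂ f₂ f₂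
  have hα₁ : ∀ x, α₁ x = inner ℝ a (f₁ x) := fun x => rfl
  have hα₂ : ∀ x, α₂ x = inner ℝ a (f₂ x) := fun x => rfl
  have hβ₁ : ∀ x y, β₁ x y = inner ℝ (f₁ x) (f₁ y) := fun x y => rfl
  have hβ₂ : ∀ x y, β₂ x y = inner ℝ (f₂ x) (f₂ y) := fun x y => rfl
  have hβ₁' : ∀ x, β₁ x x = ‖f₁ x‖ ^ 2 := fun x => real_inner_self_eq_norm_sq _
  have hβ₂' : ∀ x, β₂ x x = ‖f₂ x‖ ^ 2 := fun x => real_inner_self_eq_norm_sq _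
  have hp₁ : ∀ x, x ≠ 0 → 0 < β₁ x x := fun x hx => by
    rw [hβ₁']; exact pow_pos (norm_pos_iff.2 ((map_ne_zero_iff f₁ hf₁).2 hx)) 2
  have hp₂ : ∀ x, x ≠ 0 → 0 < β₂ x x := fun x hx => by
    rw [hβ₂']; exact pow_pos (norm_pos_iff.2 ((map_ne_zero_iff f₂ hf₂).2 hx)) 2
  let u' : ↥(H₁ ⊓ H₂) := ⟨u, hu₁, hu₂⟩
  have hfu : f₁ u' = a := hua
  have haa : inner ℝ a a = 1 := by rw [real_inner_self_eq_norm_sq, ha, one_pow]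
  -- A vector `w` of the common subspace, orthogonal to the axis and of Euclidean length one.
  obtain ⟨w₀, hw₀, hw₀α, -⟩ := exists_ne_zero_of_two_functionals hdim α₁ α₁
  have hn₀ : ‖f₁ w₀‖ ≠ 0 := norm_ne_zero_iff.2 ((map_ne_zero_iff f₁ hf₁).2 hw₀)
  obtain ⟨w, hwα, hwn⟩ : ∃ w, α₁ w = 0 ∧ ‖f₁ w‖ = 1 := by
    refine ⟨‖f₁ w₀‖⁻¹ • w₀, by simp [hw₀α], ?_⟩
    rw [map_smul, norm_smul, norm_inv, norm_norm, inv_mul_cancel₀ hn₀]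
  have hab : inner ℝ a (f₁ w) = 0 := hwα
  have hba : inner ℝ (f₁ w) a = 0 := by rw [real_inner_comm, hab]
  have hbb : inner ℝ (f₁ w) (f₁ w) = 1 := by rw [real_inner_self_eq_norm_sq, hwn, one_pow]
  have hf₁x : ∀ t y : ℝ, f₁ (t • u' + y • w) = t • a + y • f₁ w := fun t y => by
    rw [map_add, map_smul, map_smul, hfu]
  have hin : ∀ t y : ℝ, inner ℝ a (t • a + y • f₁ w) = t := fun t y => by
    simp only [inner_add_right, inner_smul_right, haa, hab]
    ring
  have hnorm : ∀ t y : ℝ, ‖t • a + y • f₁ w‖ ^ 2 = t ^ 2 + y ^ 2 := fun t y => by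
    rw [← real_inner_self_eq_norm_sq]
    simp only [inner_add_right, inner_smul_right, inner_add_left, real_inner_smul_left, haa, hab,
      hba, hbb]
    ring
  have hcs : ∀ x, 0 ≤ ‖x‖ ^ 2 - inner ℝ a x ^ 2 := fun x => by
    have := abs_real_inner_le_norm a x
    rw [ha, one_mul] at this
    rw [sub_nonneg, ← sq_abs]
    gcongr
  have hKW : IsCompact {x : ↥(H₁ ⊓ H₂) | N.comp (H₁ ⊓ H₂).subtype x ≤ 1} :=
    (H₁ ⊓ H₂).closed_of_finiteDimensional.isClosedEmbedding_subtypeVal.isCompact_preimage hK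
  rcases quadratic_or_same_axis hdim (N.comp (H₁ ⊓ H₂).subtype)
    (hNc.comp continuous_subtype_val) hKW
    (α₁ := α₁) (α₂ := α₂) (β₁ := β₁) (β₂ := β₂)
    (fun x y => real_inner_comm _ _) (fun x y => real_inner_comm _ _) hp₁ hp₂
    (fun x y h1 h2 => by
      rw [hβ₁', hβ₁'] at h2
      have := hinv _ _ h1 h2
      rwa [hpf₁, hpf₁] at this)
    (fun x y h1 h2 => by
      rw [hβ₂', hβ₂'] at h2
      have := hinv _ _ h1 h2
      rwa [hpf₂, hpf₂] at this) with ⟨l, m, hq⟩ | ⟨c, l, m, hs⟩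
  · -- The plane spanned by `u` and `w` meets every orbit of the symmetries of `p`.
    refine absurd ⟨l, m, fun x => ?_⟩ hnq
    set z := inner ℝ a x • u' + √(‖x‖ ^ 2 - inner ℝ a x ^ 2) • w with hz
    have hzα : α₁ z = inner ℝ a x := by rw [hα₁, hz, hf₁x, hin]
    have hzn : ‖f₁ z‖ ^ 2 = ‖x‖ ^ 2 := by
      rw [hz, hf₁x, hnorm, Real.sq_sqrt (hcs x)]
      ring
    have hzp : p x = p (f₁ z) := hinv _ _ hzα.symm hzn.symm
    have := hq z
    rw [hβ₁', hzn, hzα] at this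
    rw [hzp, hpf₁]
    exact this
  · have hpb : 0 < p (f₁ w) := hpos _ (by intro h; simp [h] at hwn)
    have hw₂ : ‖f₂ w‖ = 1 := by
      have h1 : inner ℝ a (f₂ w) = inner ℝ a (‖f₂ w‖ • f₁ w) := by
        rw [inner_smul_right, hab, ← hα₂, (hs w w).1, hwα]
        ring
      have h2 := hinv _ _ h1 (by rw [norm_smul, hwn, norm_norm, mul_one])
      rw [map_smul_eq_mul, norm_norm, hpf₂, ← hpf₁] at h2
      exact mul_right_cancel₀ hpb.ne' (by rw [← h2, one_mul])
    have hl : l = 1 := by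
      have := (hs w w).2
      rw [hβ₁', hβ₂', hw₂, hwn, hwα] at this
      linarith
    subst hl
    have hαu : α₁ u' = 1 := by rw [hα₁, hfu, haa]
    have hcu : inner ℝ a (f₂ u') = c := by rw [← hα₂, (hs u' u').1, hαu, mul_one]
    have hnu : ‖f₂ u'‖ ^ 2 = 1 + m := by
      rw [← hβ₂', (hs u' u').2, hβ₁', hfu, ha, hαu]; ring
    have hk : 0 ≤ 1 + m - c ^ 2 := by rw [← hnu, ← hcu]; exact hcs _
    rcases rigid_or_quadratic p hpc hpos ha hwn hab hinv (c := c) hk (fun t y => by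
      have h0 : 0 ≤ y ^ 2 + (1 + m - c ^ 2) * t ^ 2 := by positivity
      rw [← hf₁x, hpf₁, ← hpf₂]
      have hαx : α₁ (t • u' + y • w) = t := by rw [hα₁, hf₁x, hin]
      refine hinv _ _ ?_ ?_
      · rw [hin, ← hα₂, (hs _ 0).1, hαx]
      · rw [hnorm, Real.sq_sqrt h0, ← hβ₂', (hs _ _).2, hβ₁', hαx, hf₁x, hnorm]
        ring) with ⟨hc, hk0⟩ | hq
    · have hm : m = 0 := by linarith
      have hu2 : f₂ u' = c • a := by
        rw [← sub_eq_zero, ← norm_eq_zero, ← sq_eq_zero_iff, norm_sub_sq_real, inner_smul_right,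
          real_inner_comm, hcu, norm_smul, ha, hnu, Real.norm_eq_abs, mul_one, sq_abs, hm]
        linarith
      refine ⟨?_, fun x h₁ h₂ => ?_⟩
      · rcases (sq_eq_sq_iff_eq_or_eq_neg (b := (1 : ℝ))).1 (by rw [hc, one_pow]) with h | h
        · left; rw [h, one_smul] at hu2; exact hu2
        · right; rw [h, neg_one_smul] at hu2; exact hu2
      · have := (hs ⟨x, h₁, h₂⟩ u').2
        rw [hm, zero_mul, add_zero, one_mul] at this
        exact this
    · exact absurd hq hnq

/-! ### Norms with an ellipsoid or a body of revolution as unit ball -/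

/-- The unit ball of a norm satisfying the parallelogram law is an ellipsoid (Jordan and
von Neumann). -/
theorem isEllipsoid_of_parallelogram {V : Type*} [AddCommGroup V] [Module ℝ V]
    [FiniteDimensional ℝ V] (N : Seminorm ℝ V) (hpos : ∀ x, x ≠ 0 → 0 < N x)
    (hpar : ∀ x y, N (x + y) ^ 2 + N (x - y) ^ 2 = 2 * (N x ^ 2 + N y ^ 2)) :
    IsEllipsoid {x | N x ≤ 1} := by
  let _ : NormedAddCommGroup V := AddGroupNorm.toNormedAddCommGroup
    { toFun := N
      map_zero' := map_zero N
      add_le' := map_add_le_add N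
      neg' := map_neg_eq_map N
      eq_zero_of_map_eq_zero' := fun x hx => by
        by_contra h
        exact (hpos x h).ne' hx }
  have hn : ∀ x : V, ‖x‖ = N x := fun x => rfl
  let _ : NormedSpace ℝ V := ⟨fun c x => by rw [hn, hn, map_smul_eq_mul]⟩
  let _ : InnerProductSpace ℝ V := InnerProductSpace.ofNorm ℝ fun x y => by
    simpa only [hn, pow_two] using hpar x y
  let e := (stdOrthonormalBasis ℝ V).repr
  refine ⟨Module.finrank ℝ V, e.toLinearEquiv.toAffineEquiv, ?_⟩
  have : {x : V | N x ≤ 1} = Metric.closedBall (0 : V) 1 := by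
    ext x
    simp [hn]
  rw [this]
  have h := e.image_closedBall 0 1
  rw [map_zero] at h
  exact h

theorem Seminorm.le_of_unitBall_subset {V : Type*} [AddCommGroup V] [Module ℝ V]
    (p q : Seminorm ℝ V) (h : ∀ x, p x ≤ 1 → q x ≤ 1) (x : V) : q x ≤ p x := by
  refine le_of_forall_gt_imp_ge_of_dense fun r hr => ?_
  have hr0 : 0 < r := (apply_nonneg p x).trans_lt hr
  have h1 := h (r⁻¹ • x) (by
    rw [map_smul_eq_mul, norm_inv, Real.norm_of_nonneg hr0.le, inv_mul_le_iff₀ hr0, mul_one]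
    exact hr.le)
  rwa [map_smul_eq_mul, norm_inv, Real.norm_of_nonneg hr0.le, inv_mul_le_iff₀ hr0, mul_one] at h1

/-- The norm whose unit ball is a body of revolution depends only on the component along the axis
and the Euclidean norm. -/
theorem exists_axis_of_isAxisOfRevolution {m : ℕ} {K : Set (EuclideanSpace ℝ (Fin m))}
    {L : Submodule ℝ (EuclideanSpace ℝ (Fin m))} (hL : IsAxisOfRevolution K L)
    (p : Seminorm ℝ (EuclideanSpace ℝ (Fin m))) (hp : ∀ x, p x ≤ 1 ↔ x ∈ K) :
    ∃ a : EuclideanSpace ℝ (Fin m), ‖a‖ = 1 ∧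
      ∀ x y, inner ℝ a x = inner ℝ a y → ‖x‖ ^ 2 = ‖y‖ ^ 2 → p x = p y := by
  obtain ⟨hL1, hL2⟩ := hL
  obtain ⟨a, haL, ha, hspan⟩ : ∃ a ∈ L, ‖a‖ = 1 ∧ ∀ v ∈ L, ∃ s : ℝ, v = s • a := by
    obtain ⟨v, hv, hv'⟩ := finrank_eq_one_iff'.1 hL1
    have hv0 : ‖(v : EuclideanSpace ℝ (Fin m))‖ ≠ 0 := by simpa using hv
    refine ⟨‖(v : EuclideanSpace ℝ (Fin m))‖⁻¹ • (v : EuclideanSpace ℝ (Fin m)),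
      L.smul_mem _ v.2, ?_, fun w hw => ?_⟩
    · rw [norm_smul, norm_inv, norm_norm, inv_mul_cancel₀ hv0]
    · obtain ⟨c, hc⟩ := hv' ⟨w, hw⟩
      refine ⟨c * ‖(v : EuclideanSpace ℝ (Fin m))‖, ?_⟩
      rw [smul_smul, mul_assoc, mul_inv_cancel₀ hv0, mul_one]
      exact (congrArg Subtype.val hc).symm
  have haa : inner ℝ a a = 1 := by rw [real_inner_self_eq_norm_sq, ha, one_pow]
  refine ⟨a, ha, ?_⟩
  -- Membership in `K` is decided in the slice through `⟪a, x⟫ • a` orthogonal to `L`.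
  have hmem : ∀ x, x ∈ (AffineSubspace.mk' (inner ℝ a x • a) Lᗮ :
      Set (EuclideanSpace ℝ (Fin m))) := by
    intro x
    rw [SetLike.mem_coe, AffineSubspace.mem_mk', vsub_eq_sub, Submodule.mem_orthogonal]
    intro v hv
    obtain ⟨s, rfl⟩ := hspan v hv
    rw [real_inner_smul_left, inner_sub_right, inner_smul_right, haa]
    ring
  have hdist : ∀ x, dist x (inner ℝ a x • a) ^ 2 = ‖x‖ ^ 2 - inner ℝ a x ^ 2 := by
    intro x
    rw [dist_eq_norm, norm_sub_sq_real, inner_smul_right, real_inner_comm, norm_smul, ha,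
      Real.norm_eq_abs, mul_one, sq_abs]
    ring
  have hK : ∀ x y, inner ℝ a x = inner ℝ a y → ‖x‖ ^ 2 = ‖y‖ ^ 2 → x ∈ K → y ∈ K := by
    intro x y h1 h2 hx
    obtain ⟨r, hr⟩ := hL2 (inner ℝ a x • a) (L.smul_mem _ haL)
    have hx' := (Set.ext_iff.1 hr x).1 ⟨hx, hmem x⟩
    have hd : dist y (inner ℝ a x • a) = dist x (inner ℝ a x • a) := by
      rw [← sq_eq_sq₀ dist_nonneg dist_nonneg, hdist x, h1, hdist y, h2]
    refine ((Set.ext_iff.1 hr y).2 ⟨?_, by rw [h1]; exact hmem y⟩).1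
    rw [Metric.mem_closedBall, hd]
    exact hx'.1
  have hle : ∀ x y, inner ℝ a x = inner ℝ a y → ‖x‖ ^ 2 = ‖y‖ ^ 2 → p y ≤ p x := by
    intro x y h1 h2
    refine le_of_forall_gt_imp_ge_of_dense fun r hr => ?_
    have hr0 : 0 < r := (apply_nonneg p x).trans_lt hr
    have hiff : ∀ z, p z ≤ r ↔ r⁻¹ • z ∈ K := fun z => by
      rw [← hp, map_smul_eq_mul, norm_inv, Real.norm_of_nonneg hr0.le, inv_mul_le_iff₀ hr0, mul_one]
    rw [hiff]
    refine hK (r⁻¹ • x) _ ?_ ?_ ((hiff x).1 hr.le)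
    · rw [inner_smul_right, inner_smul_right, h1]
    · rw [norm_smul, norm_smul, mul_pow, mul_pow, h2]
  exact fun x y h1 h2 => le_antisymm (hle y x h1.symm h2.symm) (hle x y h1 h2)

/-! ### Hyperplanes -/

theorem isHyperplane_ker {V : Type*} [AddCommGroup V] [Module ℝ V] {f : V →ₗ[ℝ] ℝ} (hf : f ≠ 0) :
    IsHyperplane (LinearMap.ker f) := by
  have hs : Function.Surjective f := LinearMap.surjective hf
  rw [IsHyperplane, (f.quotKerEquivOfSurjective hs).finrank_eq, Module.finrank_self]

theorem IsHyperplane.finrank_add_one {V : Type*} [AddCommGroup V] [Module ℝ V]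
    [FiniteDimensional ℝ V] {H : Submodule ℝ V} (hH : IsHyperplane H) :
    Module.finrank ℝ H + 1 = Module.finrank ℝ V := by
  have := H.finrank_quotient_add_finrank
  rw [IsHyperplane] at hH
  omega

theorem IsHyperplane.le_finrank_inf_add_two {V : Type*} [AddCommGroup V] [Module ℝ V]
    [FiniteDimensional ℝ V] {H₁ H₂ : Submodule ℝ V} (h₁ : IsHyperplane H₁)
    (h₂ : IsHyperplane H₂) : Module.finrank ℝ V ≤ Module.finrank ℝ ↥(H₁ ⊓ H₂) + 2 := by
  have h := Submodule.finrank_sup_add_finrank_inf_eq H₁ H₂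
  have := Submodule.finrank_le (H₁ ⊔ H₂)
  have := h₁.finrank_add_one
  have := h₂.finrank_add_one
  omega

theorem exists_isHyperplane_of_three {V : Type*} [AddCommGroup V] [Module ℝ V]
    (hV : 4 ≤ Module.finrank ℝ V) (x y z : V) :
    ∃ H : Submodule ℝ V, IsHyperplane H ∧ x ∈ H ∧ y ∈ H ∧ z ∈ H := by
  classical
  have hlt : Submodule.span ℝ (({x, y, z} : Finset V) : Set V) < ⊤ := by
    rw [lt_top_iff_ne_top]
    intro h
    have h1 := finrank_span_finset_le_card (R := ℝ) ({x, y, z} : Finset V)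
    have h2 := Finset.card_le_three (a := x) (b := y) (c := z)
    rw [Set.finrank, h, finrank_top] at h1
    omega
  obtain ⟨f, hf, hle⟩ := Submodule.exists_le_ker_of_lt_top _ hlt
  refine ⟨_, isHyperplane_ker hf, hle (Submodule.subset_span ?_), hle (Submodule.subset_span ?_),
    hle (Submodule.subset_span ?_)⟩ <;> simp

/-! ### The norm of a symmetric convex body -/

/-- The norm whose unit ball is a given symmetric convex body. -/
theorem IsSymmetricConvexBody.exists_seminorm {V : Type*} [NormedAddCommGroup V]
    [NormedSpace ℝ V] {B : Set V} (hB : IsSymmetricConvexBody B) :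
    ∃ N : Seminorm ℝ V, Continuous N ∧ (∀ x, x ≠ 0 → 0 < N x) ∧ ∀ x, N x ≤ 1 ↔ x ∈ B := by
  obtain ⟨hcomp, hconv, ⟨x₀, hx₀⟩, hsymm⟩ := hB
  have h0 : (0 : V) ∈ interior B := by
    have hneg : -x₀ ∈ interior B := by
      have hsub : -interior B ⊆ interior B := by
        refine interior_maximal (fun x hx => ?_) isOpen_interior.neg
        simpa using hsymm _ (interior_subset hx)
      exact hsub (by simpa using hx₀)
    have := hconv.interior hx₀ hneg (a := 1 / 2) (b := 1 / 2) (by norm_num) (by norm_num)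
      (by norm_num)
    simpa using this
  have hnhds : B ∈ nhds (0 : V) := mem_interior_iff_mem_nhds.1 h0
  have hbal : Balanced ℝ B := by
    refine balanced_iff_smul_mem.2 fun {c} hc {x} hx => ?_
    rw [Real.norm_eq_abs, abs_le] at hc
    have := hconv hx (hsymm x hx) (a := (1 + c) / 2) (b := (1 - c) / 2) (by linarith)
      (by linarith) (by ring)
    have he : ((1 + c) / 2) • x + ((1 - c) / 2) • -x = c • x := by module
    rwa [he] at this
  have habs : Absorbent ℝ B := absorbent_nhds_zero hnhds
  refine ⟨gaugeSeminorm hbal hconv habs, continuous_gauge hconv hnhds, fun x hx => ?_, fun x => ?_⟩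
  · exact (gauge_pos habs (NormedSpace.isVonNBounded_of_isBounded ℝ hcomp.isBounded)).2 hx
  · have := gauge_le_one_iff_mem_closure (x := x) hconv hnhds
    rwa [hcomp.isClosed.closure_eq] at this

/-- A linear isomorphism carrying the unit ball of one norm onto that of another is an isometry. -/
theorem apply_eq_of_image_unitBall {V E : Type*} [AddCommGroup V] [Module ℝ V] [AddCommGroup E]
    [Module ℝ E] (N : Seminorm ℝ V) (p : Seminorm ℝ E) {S : Set V} {T : Set E}
    (hN : ∀ x, N x ≤ 1 ↔ x ∈ S) (hp : ∀ x, p x ≤ 1 ↔ x ∈ T) (e : V ≃ₗ[ℝ] E)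
    (he : e '' S = T) (x : V) : p (e x) = N x := by
  have h : ∀ x, p (e x) ≤ 1 ↔ N x ≤ 1 := fun x => by
    rw [hN, hp, ← he, e.injective.mem_set_image]
  exact le_antisymm
    (Seminorm.le_of_unitBall_subset N (p.comp e.toLinearMap) (fun x => (h x).2) x)
    (Seminorm.le_of_unitBall_subset (p.comp e.toLinearMap) N (fun x => (h x).1) x)

/-! ### Gluing the heights over the hyperplanes of revolution -/

/-- If all hyperplanes of a space of dimension at least five are isometric to one norm of
revolution `p`, then `p` is Euclidean: otherwise all hyperplanes through an axis `u` have the axis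
`u`, their heights over the hyperplanes of revolution glue to a linear functional, and the kernel
of that functional is a hyperplane with Euclidean norm. -/
theorem parallelogram_of_hyperplanes {V E : Type*} [NormedAddCommGroup V] [NormedSpace ℝ V]
    [FiniteDimensional ℝ V] [NormedAddCommGroup E] [InnerProductSpace ℝ E]
    (hV : 5 ≤ Module.finrank ℝ V)
    (N : Seminorm ℝ V) (hNc : Continuous N) (hK : IsCompact {x | N x ≤ 1})
    (p : Seminorm ℝ E) (hpc : Continuous p) (hpos : ∀ x, x ≠ 0 → 0 < p x) {a : E}
    (ha : ‖a‖ = 1)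
    (hinv : ∀ x y, inner ℝ a x = inner ℝ a y → ‖x‖ ^ 2 = ‖y‖ ^ 2 → p x = p y)
    (hiso : ∀ H : Submodule ℝ V, IsHyperplane H → ∃ e : H ≃ₗ[ℝ] E, ∀ x, p (e x) = N x) (v w : E) :
    p (v + w) ^ 2 + p (v - w) ^ 2 = 2 * (p v ^ 2 + p w ^ 2) := by
  by_cases hq : ∃ l m : ℝ, ∀ x, p x ^ 2 = l * ‖x‖ ^ 2 + m * inner ℝ a x ^ 2
  · obtain ⟨l, m, hq⟩ := hq
    have := parallelogram_law_with_norm ℝ v w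
    simp only [hq, inner_add_right, inner_sub_right]
    linear_combination l * this
  have haa : inner ℝ a a = 1 := by rw [real_inner_self_eq_norm_sq, ha, one_pow]
  choose e he using hiso
  have hdim : ∀ {H₁ H₂ : Submodule ℝ V}, IsHyperplane H₁ → IsHyperplane H₂ →
      3 ≤ Module.finrank ℝ ↥(H₁ ⊓ H₂) := fun h₁ h₂ => by
    have := h₁.le_finrank_inf_add_two h₂
    omega
  obtain ⟨H₀, hH₀, -⟩ := exists_isHyperplane_of_three (by omega) (0 : V) 0 0
  let u : V := ((e H₀ hH₀).symm a : H₀)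
  have huH₀ : u ∈ H₀ := Subtype.property _
  have hu₀ : e H₀ hH₀ ⟨u, huH₀⟩ = a := (e H₀ hH₀).apply_symm_apply a
  have haxis : ∀ H (hH : IsHyperplane H) (huH : u ∈ H),
      e H hH ⟨u, huH⟩ = a ∨ e H hH ⟨u, huH⟩ = -a := fun H hH huH =>
    (same_axis_of_mem_inf N hNc hK p hpc hpos ha hinv hq (hdim hH₀ hH) _ _ (he H₀ hH₀) (he H hH)
      huH₀ huH hu₀).1
  have hheight : ∀ H (hH : IsHyperplane H) (huH : u ∈ H) H' (hH' : IsHyperplane H') (huH' : u ∈ H')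
      x (hx : x ∈ H) (hx' : x ∈ H'), inner ℝ (e H' hH' ⟨x, hx'⟩) (e H' hH' ⟨u, huH'⟩) =
        inner ℝ (e H hH ⟨x, hx⟩) (e H hH ⟨u, huH⟩) := by
    intro H hH huH H' hH' huH' x hx hx'
    rcases haxis H hH huH with h | h
    · exact (same_axis_of_mem_inf N hNc hK p hpc hpos ha hinv hq (hdim hH hH') _ _ (he H hH)
        (he H' hH') huH huH' h).2 x hx hx'
    · have hneg : ∀ H (hH : IsHyperplane H) (huH : u ∈ H),
          e H hH ⟨-u, H.neg_mem huH⟩ = -e H hH ⟨u, huH⟩ := fun H hH huH => by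
        rw [← map_neg]; rfl
      have := (same_axis_of_mem_inf N hNc hK p hpc hpos ha hinv hq (hdim hH hH') _ _ (he H hH)
        (he H' hH') (H.neg_mem huH) (H'.neg_mem huH')
        (by rw [hneg H hH huH, h, neg_neg])).2 x hx hx'
      rw [hneg H hH huH, hneg H' hH' huH', inner_neg_right, inner_neg_right] at this
      exact neg_injective this
  have hex : ∀ x, ∃ H, IsHyperplane H ∧ u ∈ H ∧ x ∈ H := fun x => by
    obtain ⟨H, h1, h2, h3, -⟩ := exists_isHyperplane_of_three (by omega) u x 0
    exact ⟨H, h1, h2, h3⟩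
  choose H hH huH hxH using hex
  let φ : V → ℝ := fun x => inner ℝ (e (H x) (hH x) ⟨x, hxH x⟩) (e (H x) (hH x) ⟨u, huH x⟩)
  have hφ : ∀ x H' (hH' : IsHyperplane H') (huH' : u ∈ H') (hx' : x ∈ H'),
      φ x = inner ℝ (e H' hH' ⟨x, hx'⟩) (e H' hH' ⟨u, huH'⟩) := fun x H' hH' huH' hx' =>
    hheight H' hH' huH' (H x) (hH x) (huH x) x hx' (hxH x)
  let θ : V →ₗ[ℝ] ℝ :=
    { toFun := φ
      map_add' := fun x y => by
        obtain ⟨H', hH', huH', hx, hy⟩ := exists_isHyperplane_of_three (by omega) u x y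
        rw [hφ x H' hH' huH' hx, hφ y H' hH' huH' hy, hφ (x + y) H' hH' huH' (H'.add_mem hx hy),
          ← inner_add_left, ← map_add]
        rfl
      map_smul' := fun c x => by
        rw [hφ (c • x) (H x) (hH x) (huH x) ((H x).smul_mem c (hxH x)), RingHom.id_apply,
          smul_eq_mul, ← real_inner_smul_left, ← map_smul]
        rfl }
  have hθ : θ ≠ 0 := by
    intro h
    have h1 : φ u = 0 := congrArg (fun f : V →ₗ[ℝ] ℝ => f u) h
    rw [hφ u H₀ hH₀ huH₀ huH₀, hu₀, haa] at h1
    exact one_ne_zero h1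
  -- On the orthogonal complement of the axis, `p` is a multiple of the Euclidean norm.
  obtain ⟨D, hD⟩ : ∃ D : ℝ, ∀ z, inner ℝ a z = 0 → p z = D * ‖z‖ := by
    by_cases h : ∃ z₀ : E, z₀ ≠ 0 ∧ inner ℝ a z₀ = 0
    · obtain ⟨z₀, hz₀, hz₀a⟩ := h
      have hn : ‖z₀‖ ≠ 0 := norm_ne_zero_iff.2 hz₀
      refine ⟨p z₀ / ‖z₀‖, fun z hz => ?_⟩
      have : p z = p ((‖z‖ / ‖z₀‖) • z₀) := by
        refine hinv _ _ (by rw [inner_smul_right, hz, hz₀a, mul_zero]) ?_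
        rw [norm_smul, norm_div, norm_norm, norm_norm, div_mul_cancel₀ _ hn]
      rw [this, map_smul_eq_mul, norm_div, norm_norm, norm_norm]
      ring
    · refine ⟨0, fun z hz => ?_⟩
      have : z = 0 := by
        by_contra h0
        exact h ⟨z, h0, hz⟩
      simp [this]
  have hNker : ∀ x y, θ x = 0 → θ y = 0 →
      N (x + y) ^ 2 + N (x - y) ^ 2 = 2 * (N x ^ 2 + N y ^ 2) := by
    intro x y hx hy
    obtain ⟨H', hH', huH', hxH', hyH'⟩ := exists_isHyperplane_of_three (by omega) u x y
    have hval : ∀ z : H', θ z = 0 → N z = D * ‖e H' hH' z‖ := by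
      intro z hz
      rw [← he H' hH', hD]
      have h1 : φ z = 0 := hz
      rw [hφ z H' hH' huH' z.2] at h1
      rcases haxis H' hH' huH' with h | h
      · rwa [h, real_inner_comm] at h1
      · rwa [h, inner_neg_right, real_inner_comm, neg_eq_zero] at h1
    have h1 := hval ⟨x, hxH'⟩ hx
    have h2 := hval ⟨y, hyH'⟩ hy
    have h3 := hval (⟨x, hxH'⟩ + ⟨y, hyH'⟩) (by simp [hx, hy])
    have h4 := hval (⟨x, hxH'⟩ - ⟨y, hyH'⟩) (by simp [hx, hy])
    rw [map_add] at h3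
    rw [map_sub] at h4
    simp only [Submodule.coe_add, Submodule.coe_sub] at h1 h2 h3 h4
    rw [h1, h2, h3, h4]
    linear_combination D ^ 2 *
      parallelogram_law_with_norm ℝ (e H' hH' ⟨x, hxH'⟩) (e H' hH' ⟨y, hyH'⟩)
  have hker := isHyperplane_ker hθ
  obtain ⟨x, rfl⟩ := (e _ hker).surjective v
  obtain ⟨y, rfl⟩ := (e _ hker).surjective w
  rw [← map_add, ← map_sub, he, he, he, he]
  exact hNker x y x.2 y.2

theorem theorem2 (n : ℕ) (hn : 4 ≤ n) (B : Set (EuclideanSpace ℝ (Fin (n + 1))))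
    (hB : IsSymmetricConvexBody B)
    (hequiv : ∀ H₁ H₂ : Submodule ℝ (EuclideanSpace ℝ (Fin (n + 1))),
      IsHyperplane H₁ → IsHyperplane H₂ →
        LinearlyEquivalent (sectionBy B H₁) (sectionBy B H₂))
    (hrev : ∀ H : Submodule ℝ (EuclideanSpace ℝ (Fin (n + 1))),
      IsHyperplane H → IsAffineBodyOfRevolution (sectionBy B H)) :
    IsEllipsoid B := by
  have hV : Module.finrank ℝ (EuclideanSpace ℝ (Fin (n + 1))) = n + 1 := finrank_euclideanSpace_fin
  obtain ⟨N, hNc, hNpos, hNB⟩ := hB.exists_seminorm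
  have hBN : {x | N x ≤ 1} = B := Set.ext hNB
  have hK : IsCompact {x | N x ≤ 1} := by rw [hBN]; exact hB.1
  obtain ⟨H₀, hH₀, -⟩ := exists_isHyperplane_of_three (by omega)
    (0 : EuclideanSpace ℝ (Fin (n + 1))) 0 0
  obtain ⟨m, K, ⟨-, L, hL⟩, e₀, he₀⟩ := hrev H₀ hH₀
  -- The norm of the model body, transported from the section by `H₀`.
  let p : Seminorm ℝ (EuclideanSpace ℝ (Fin m)) := N.comp (H₀.subtype ∘ₗ e₀.symm.toLinearMap)
  have hp : ∀ x, p x ≤ 1 ↔ x ∈ K := fun x => by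
    rw [← he₀, ← e₀.apply_symm_apply x, e₀.injective.mem_set_image]
    have := hNB (e₀.symm x)
    rw [e₀.apply_symm_apply]
    exact this
  have hpc : Continuous p :=
    hNc.comp (LinearMap.continuous_of_finiteDimensional (H₀.subtype ∘ₗ e₀.symm.toLinearMap))
  have hpos : ∀ x, x ≠ 0 → 0 < p x := fun x hx => hNpos _ (by simpa using hx)
  obtain ⟨a, ha, hinv⟩ := exists_axis_of_isAxisOfRevolution hL p hp
  have hiso : ∀ H : Submodule ℝ (EuclideanSpace ℝ (Fin (n + 1))), IsHyperplane H →
      ∃ e : H ≃ₗ[ℝ] EuclideanSpace ℝ (Fin m), ∀ x, p (e x) = N x := by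
    intro H hH
    obtain ⟨e, he⟩ := hequiv H H₀ hH hH₀
    refine ⟨e.trans e₀, apply_eq_of_image_unitBall (N.comp H.subtype) p (S := sectionBy B H)
      (fun x => hNB x) hp _ ?_⟩
    rw [← he₀, ← he, Set.image_image]
    rfl
  have hpar := parallelogram_of_hyperplanes (by omega) N hNc hK p hpc hpos ha hinv hiso
  rw [← hBN]
  refine isEllipsoid_of_parallelogram N hNpos fun x y => ?_
  obtain ⟨H, hH, hx, hy, -⟩ := exists_isHyperplane_of_three (by omega) x y 0
  obtain ⟨e, he⟩ := hiso H hH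
  have h := hpar (e ⟨x, hx⟩) (e ⟨y, hy⟩)
  rw [← map_add, ← map_sub, he, he, he, he] at h
  exact h
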